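/- Let $R$ be the ring of integers or an arbitrary field, let $V$ be a free $R$-module and let $r$ be a positive integer. Let $T(V)=\bigoplus_{i\ge 0}T^i(V)$ be the tensor algebra of $V$ with its grading, let $L(V)$ be the Lie subalgebra of $T(V)$ generated by $V$ under $[a,b]=ab-ba$, and let $L^i(V)=T^i(V)\cap L(V)$. *The filtration.* For a partition $\lambda$ of $r$, let $\mathcal X_\lambda$ be the set of all products $b_1b_2\cdots b_l\in T^r(V)$ with $b_i\in L^{\mu_i}(V)$, where $(\mu_1,\dots,\mu_l)$ is a composition of $r$ whose non-increasing rearrangement is $\lambda$. Let $\leq^*$ be the lexicographic order on partitions of $r$ (written with non-increasing parts), and let $W_\lambda$ be the $R$-span of all $\mathcal X_\theta$ with $\lambda\leq^*\theta$. Let $W_{\lambda+}$ be the $R$-span of all $\mathcal X_\theta$ with $\lambda<^*\theta$; thus $W_{\lambda+}=W_{\lambda'}$ if $\lambda'$ is the next bigger partition, and $W_{(r)+}=0$. *The descent algebra.* Permutations in $\mathrm{Sym}(r)$ are written on the right of their arguments and composed from left to right. The group ring $R\,\mathrm{Sym}(r)$ acts on the left on $T^r(V)$ by place permutations, $\sigma(v_1v_2\cdots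 v_r)=v_{1\sigma}v_{2\sigma}\cdots v_{r\sigma}$ for $v_1,\dots,v_r\in V$. For a composition $\nu=(\nu_1,\dots,\nu_k)$ of $r$ let $X^\nu\in R\,\mathrm{Sym}(r)$ be the sum of all $\sigma\in\mathrm{Sym}(r)$ whose descent set $\{i: 1\le i<r,\ i\sigma>(i+1)\sigma\}$ is contained in $\{\nu_1,\nu_1+\nu_2,\dots,\nu_1+\cdots+\nu_{k-1}\}$. The elements $X^\nu$ form an $R$-basis of a subalgebra $D_{r,R}$ of $R\,\mathrm{Sym}(r)$, the descent algebra. Let $\phi^\nu$ be the Young character of $\mathrm{Sym}(r)$, that is, the character (in characteristic $0$) induced from the trivial character of the Young subgroup $\mathrm{Sym}(\nu_1)\times\cdots\times\mathrm{Sym}(\nu_k)$. Let $c_{r,R}$ be the $R$-linear map from $D_{r,R}$ to the class functions $\mathrm{Sym}(r)\to R$ such that $c_{r,R}(X^\nu)(\sigma)=\phi^\nu(\sigma)1_R$ for all $\nu$ and $\sigma$. For $X\in D_{r,R}$, write $(c_{r,R}(X))(\lambda)$ for the value of $c_{r,R}(X)$ on the conjugacy class of permutations of cycle type $\lambda$.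 **Proposition 3.3.** For each partition $\lambda$ of $r$, $W_\lambda$ and $W_{\lambda+}$ are $D_{r,R}$-submodules of $T^r(V)$, with $W_{\lambda+}\subseteq W_\lambda$. For all $X\in D_{r,R}$, the action of $X$ on $W_\lambda/W_{\lambda+}$ is multiplication by the element $(c_{r,R}(X))(\lambda)$ of $R$. -/

import Mathlib

open scoped TensorProduct

namespace PBWDescent

/-! ### The group ring of the symmetric group and its action by place permutations -/

/-- The group algebra `R Sym(r)`.  Permutations are written on the right and composed from left to
right: `i(στ) = (iσ)τ`.  Since multiplication in `Equiv.Perm` is composition from right to left,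
`Sym(r)` in this convention is the opposite group `(Equiv.Perm (Fin r))ᵐᵒᵖ`. -/
abbrev SymAlgebra (R : Type*) [CommRing R] (r : ℕ) : Type _ :=
  MonoidAlgebra R (Equiv.Perm (Fin r))ᵐᵒᵖ

/-- The left action of `Sym(r)` on `T^r(V) = V ⊗ ⋯ ⊗ V` by place permutations,
`σ (v₁ v₂ ⋯ v_r) = v_{1σ} v_{2σ} ⋯ v_{rσ}`. -/
noncomputable def placePerm (R : Type*) [CommRing R] (V : Type*) [AddCommGroup V] [Module R V]
    (r : ℕ) : Representation R (Equiv.Perm (Fin r))ᵐᵒᵖ (⨂[R]^r V) where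
  toFun g := (PiTensorProduct.reindex R (fun _ : Fin r => V) g.unop.symm).toLinearMap
  map_one' := by
    ext v
    simp only [LinearMap.compMultilinearMap_apply, LinearEquiv.coe_coe,
      PiTensorProduct.reindex_tprod]
    rfl
  map_mul' g h := by
    ext v
    simp only [LinearMap.compMultilinearMap_apply, LinearEquiv.coe_coe, Module.End.mul_apply,
      PiTensorProduct.reindex_tprod]
    rfl

theorem placePerm_tprod (R : Type*) [CommRing R] (V : Type*) [AddCommGroup V] [Module R V]
    (r : ℕ) (σ : Equiv.Perm (Fin r)) (v : Fin r → V) :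
    placePerm R V r (MulOpposite.op σ) (PiTensorProduct.tprod R v) =
      PiTensorProduct.tprod R (fun i => v (σ i)) := by
  change PiTensorProduct.reindex R (fun _ : Fin r => V) σ.symm (PiTensorProduct.tprod R v) = _
  rw [PiTensorProduct.reindex_tprod]
  rfl

/-- `T^r(V)` as an `R Sym(r)`-module. -/
noncomputable instance symModule (R : Type*) [CommRing R] (V : Type*) [AddCommGroup V]
    [Module R V] (r : ℕ) : Module (SymAlgebra R r) (⨂[R]^r V) :=
  Module.compHom (⨂[R]^r V) (placePerm R V r).asAlgebraHom.toRingHom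

theorem symModule_smul_def (R : Type*) [CommRing R] (V : Type*) [AddCommGroup V]
    [Module R V] (r : ℕ) (X : SymAlgebra R r) (w : ⨂[R]^r V) :
    X • w = (placePerm R V r).asAlgebraHom X w := rfl

instance symModule_isScalarTower (R : Type*) [CommRing R] (V : Type*) [AddCommGroup V]
    [Module R V] (r : ℕ) : IsScalarTower R (SymAlgebra R r) (⨂[R]^r V) :=
  ⟨fun a X w => by simp only [symModule_smul_def, map_smul, LinearMap.smul_apply]⟩

section LiePowers

attribute [local instance] LieRing.ofAssociativeRing

/-! ### Lie powers and the PBW-filtration -/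

/-- `L(V)`: the Lie subalgebra of the tensor algebra `T(V)` generated by `V`. -/
noncomputable def freeLie (R : Type*) [CommRing R] (V : Type*) [AddCommGroup V] [Module R V] :
    LieSubalgebra R (TensorAlgebra R V) :=
  LieSubalgebra.lieSpan R (TensorAlgebra R V) (Set.range (TensorAlgebra.ι R (M := V)))

/-- `L^i(V) = T^i(V) ∩ L(V)`, inside `T(V)`; the homogeneous component `T^i(V)` of `T(V)` is the
`i`-th power of the submodule `V` of `T(V)`. -/
noncomputable def liePower (R : Type*) [CommRing R] (V : Type*) [AddCommGroup V] [Module R V]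
    (i : ℕ) : Submodule R (TensorAlgebra R V) :=
  LinearMap.range (TensorAlgebra.ι R (M := V)) ^ i ⊓ (freeLie R V).toSubmodule

end LiePowers

/-- The parts `λ₁ ≥ λ₂ ≥ ⋯` of a partition as a list. -/
def partList {r : ℕ} (lam : r.Partition) : List ℕ := lam.parts.sort (· ≥ ·)

/-- `𝒳_λ`: all elements `b₁ b₂ ⋯ b_l` of `T^r(V)` with `b_i ∈ L^{μ_i}(V)`, where
`μ = (μ₁, …, μ_l)` is a composition of `r` with associated partition `λ`.  Here
`T^r(V) = V ⊗ ⋯ ⊗ V` is identified with the homogeneous component of degree `r` of `T(V)` by the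
(injective) canonical map `v₁ ⊗ ⋯ ⊗ v_r ↦ v₁ ⋯ v_r`. -/
def pbwProducts (R : Type*) [CommRing R] (V : Type*) [AddCommGroup V] [Module R V] {r : ℕ}
    (lam : r.Partition) : Set (⨂[R]^r V) :=
  {t | ∃ μ : Composition r, Nat.Partition.ofComposition r μ = lam ∧
    ∃ b : Fin μ.length → TensorAlgebra R V,
      (∀ i, b i ∈ liePower R V (μ.blocksFun i)) ∧
      TensorPower.toTensorAlgebra t = (List.ofFn b).prod}

/-- `W_λ`: the span of all `𝒳_θ` with `λ ≤* θ` (lexicographic order). -/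
def pbwFiltration (R : Type*) [CommRing R] (V : Type*) [AddCommGroup V] [Module R V] {r : ℕ}
    (lam : r.Partition) : Submodule R (⨂[R]^r V) :=
  Submodule.span R (⋃ θ : {θ : r.Partition // partList lam ≤ partList θ}, pbwProducts R V θ.1)

/-- `W_{λ+}`: the span of all `𝒳_θ` with `λ <* θ`.  This is `W_{λ'}` for the next bigger
partition `λ'` if there is one, and it is `0` for the largest partition `(r)`. -/
def pbwFiltrationNext (R : Type*) [CommRing R] (V : Type*) [AddCommGroup V] [Module R V] {r : ℕ}
    (lam : r.Partition) : Submodule R (⨂[R]^r V) :=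
  Submodule.span R (⋃ θ : {θ : r.Partition // partList lam < partList θ}, pbwProducts R V θ.1)

theorem pbwFiltrationNext_eq (R : Type*) [CommRing R] (V : Type*) [AddCommGroup V] [Module R V]
    {r : ℕ} (lam lam' : r.Partition) (h : partList lam < partList lam')
    (hnext : ∀ θ : r.Partition, partList lam < partList θ → partList lam' ≤ partList θ) :
    pbwFiltrationNext R V lam = pbwFiltration R V lam' := by
  unfold pbwFiltrationNext pbwFiltration
  congr 1
  ext t
  simp only [Set.mem_iUnion, Subtype.exists, exists_prop]
  exact ⟨fun ⟨θ, h1, h2⟩ => ⟨θ, hnext θ h1, h2⟩, fun ⟨θ, h1, h2⟩ => ⟨θ, lt_of_lt_of_le h h1, h2⟩⟩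

theorem pbwFiltrationNext_eq_bot (R : Type*) [CommRing R] (V : Type*) [AddCommGroup V]
    [Module R V] {r : ℕ} (lam : r.Partition)
    (h : ∀ θ : r.Partition, partList θ ≤ partList lam) : pbwFiltrationNext R V lam = ⊥ := by
  unfold pbwFiltrationNext
  rw [Submodule.span_eq_bot]
  intro t ht
  obtain ⟨⟨θ, hθ⟩, -⟩ := Set.mem_iUnion.1 ht
  exact absurd hθ (not_lt.2 (h θ))

/-! ### Solomon's descent algebra -/

/-- The word `1σ, 2σ, …, rσ` increases on each of the consecutive blocks of lengths
`ν₁, ν₂, …, ν_k`; that is, the descent set of `σ` is contained in `{ν₁, ν₁ + ν₂, …}`. -/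
def BlockIncreasing {r : ℕ} (ν : Composition r) (σ : Equiv.Perm (Fin r)) : Prop :=
  ∀ i j : Fin r, i < j → ν.index i = ν.index j → σ i < σ j

instance {r : ℕ} (ν : Composition r) : DecidablePred (BlockIncreasing ν) := fun σ => by
  unfold BlockIncreasing
  infer_instance

/-- `X^ν`: the sum in `R Sym(r)` of the permutations whose descent set is contained in
`{ν₁, ν₁ + ν₂, …}`. -/
noncomputable def descentElt (R : Type*) [CommRing R] {r : ℕ} (ν : Composition r) :
    SymAlgebra R r :=
  ∑ σ : Equiv.Perm (Fin r) with BlockIncreasing ν σ,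
    MonoidAlgebra.single (MulOpposite.op σ) (1 : R)

theorem perm_apply_inv {r : ℕ} (σ : Equiv.Perm (Fin r)) (i : Fin r) : σ (σ⁻¹ i) = i :=
  σ.apply_symm_apply i

theorem index_mono {r : ℕ} (c : Composition r) : Monotone c.index := by
  intro i j hij
  by_contra h
  rw [not_le] at h
  have h1 := c.sizeUpTo_index_le i
  have h2 := c.lt_sizeUpTo_index_succ j
  have h3 : c.sizeUpTo (c.index j).succ ≤ c.sizeUpTo (c.index i) :=
    c.monotone_sizeUpTo (by simpa using h)
  have : (i : ℕ) ≤ j := hij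
  omega

theorem sizeUpTo_le_iff {r : ℕ} (c : Composition r) (k : ℕ) (i : Fin r) :
    c.sizeUpTo k ≤ i ↔ k ≤ (c.index i : ℕ) := by
  constructor
  · intro h
    by_contra h'
    have h2 := c.lt_sizeUpTo_index_succ i
    have h3 : c.sizeUpTo (c.index i).succ ≤ c.sizeUpTo k :=
      c.monotone_sizeUpTo (by simp; omega)
    omega
  · intro h
    exact (c.monotone_sizeUpTo h).trans (c.sizeUpTo_index_le i)

theorem index_eq_iff {r : ℕ} (c : Composition r) (i j : Fin r) :
    c.index i = c.index j ↔ ∀ b ∈ c.boundaries, ((b : ℕ) ≤ i ↔ (b : ℕ) ≤ j) := by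
  have hb : ∀ b : Fin (r + 1), b ∈ c.boundaries ↔ ∃ k ≤ c.length, (b : ℕ) = c.sizeUpTo k := by
    intro b
    simp only [Composition.boundaries, Finset.mem_map, Finset.mem_univ, true_and]
    constructor
    · rintro ⟨k, rfl⟩
      exact ⟨k, Nat.lt_succ_iff.1 k.2, rfl⟩
    · rintro ⟨k, hk, hb⟩
      exact ⟨⟨k, Nat.lt_succ_iff.2 hk⟩, Fin.ext hb.symm⟩
  constructor
  · intro h b hbm
    obtain ⟨k, -, hk⟩ := (hb b).1 hbm
    rw [hk, sizeUpTo_le_iff, sizeUpTo_le_iff, h]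
  · intro h
    have key : ∀ k ≤ c.length, (k ≤ (c.index i : ℕ) ↔ k ≤ (c.index j : ℕ)) := by
      intro k hk
      have := h ⟨c.sizeUpTo k, Nat.lt_succ_iff.2 (c.sizeUpTo_le k)⟩ ((hb _).2 ⟨k, hk, rfl⟩)
      simpa only [sizeUpTo_le_iff] using this
    have h1 := (key _ (c.index i).2.le).1 le_rfl
    have h2 := (key _ (c.index j).2.le).2 le_rfl
    exact Fin.ext (le_antisymm h1 h2)

theorem exists_composition {r : ℕ} {β : Type*} [LinearOrder β] (h : Fin r → β)
    (hm : Monotone h) : ∃ θ : Composition r, ∀ i j, θ.index i = θ.index j ↔ h i = h j := by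
  classical
  let S : CompositionAsSet r :=
    { boundaries := Finset.univ.filter
        (fun b : Fin (r + 1) => ∀ i j : Fin r, (i : ℕ) < b → (b : ℕ) ≤ j → h i < h j)
      zero_mem := by simp
      getLast_mem := by
        simp only [Finset.mem_filter, Finset.mem_univ, true_and, Fin.val_last]
        intro i j _ hj
        exact absurd j.2 (not_lt.2 hj) }
  have hS : ∀ b : Fin (r + 1), b ∈ S.toComposition.boundaries ↔
      ∀ i j : Fin r, (i : ℕ) < b → (b : ℕ) ≤ j → h i < h j := by
    intro b
    rw [CompositionAsSet.toComposition_boundaries]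
    simp [S]
  refine ⟨S.toComposition, fun i j => ?_⟩
  wlog hij : i ≤ j generalizing i j
  · rw [eq_comm, this j i (le_of_not_ge hij), eq_comm]
  rw [index_eq_iff]
  constructor
  · intro H
    by_contra hne
    have hlt : h i < h j := lt_of_le_of_ne (hm hij) hne
    -- the first position at which the value exceeds `h i`
    let P : ℕ → Prop := fun n => ∃ hn : n < r, h i < h ⟨n, hn⟩
    have hP : ∃ n, P n := ⟨j, j.2, hlt⟩
    obtain ⟨hn, hn'⟩ := Nat.find_spec hP
    have hmin : ∀ m (hmr : m < r), m < Nat.find hP → h ⟨m, hmr⟩ ≤ h i := by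
      intro m hmr hm'
      have := Nat.find_min hP hm'
      by_contra hc
      exact this ⟨hmr, not_le.1 hc⟩
    have hnj : Nat.find hP ≤ j := Nat.find_min' hP ⟨j.2, hlt⟩
    have hin : (i : ℕ) < Nat.find hP := by
      by_contra hc
      have : h ⟨Nat.find hP, hn⟩ ≤ h i := hm (by rw [Fin.le_def]; exact not_lt.1 hc)
      exact absurd hn' (not_lt.2 this)
    have := (H ⟨Nat.find hP, by omega⟩ ((hS _).2 (by
      intro a b ha hb
      exact lt_of_le_of_lt (hmin a a.2 ha)
        (lt_of_lt_of_le hn' (hm (by rw [Fin.le_def]; exact hb)))))).2 hnj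
    exact absurd hin (not_lt.2 this)
  · intro heq b hb
    have hij' : (i : ℕ) ≤ j := hij
    refine ⟨fun h1 => h1.trans hij', fun h1 => ?_⟩
    by_contra hc
    exact absurd heq (ne_of_lt ((hS b).1 hb i j (not_le.1 hc) h1))

theorem composition_eq_of_index {r : ℕ} (ν θ : Composition r)
    (h : ∀ i j, ν.index i = ν.index j ↔ θ.index i = θ.index j) : ν = θ := by
  have key : ∀ ν θ : Composition r, (∀ i j, ν.index i = ν.index j → θ.index i = θ.index j) →
      θ.boundaries ⊆ ν.boundaries := by
    intro ν θ h b hb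
    by_cases h0 : b = 0
    · subst h0
      exact ν.toCompositionAsSet.zero_mem
    by_cases hl : b = Fin.last r
    · subst hl
      exact ν.toCompositionAsSet.getLast_mem
    have hb0 : 0 < (b : ℕ) := Nat.pos_of_ne_zero fun hc => h0 (Fin.ext hc)
    have hbr : (b : ℕ) < r :=
      lt_of_le_of_ne (Nat.lt_succ_iff.1 b.2) fun hc => hl (Fin.ext hc)
    by_contra hnb
    have hne : ν.index ⟨b - 1, by omega⟩ = ν.index ⟨b, hbr⟩ := by
      rw [index_eq_iff]
      intro c hc
      have hcb : (c : ℕ) ≠ b := fun hc' => hnb (by rwa [← Fin.ext hc'])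
      simp only
      omega
    have := ((index_eq_iff _ _ _).1 (h _ _ hne) b hb).2 le_rfl
    simp only at this
    omega
  apply (compositionEquiv r).injective
  apply CompositionAsSet.ext
  exact Finset.Subset.antisymm (key θ ν fun i j => (h i j).2) (key ν θ fun i j => (h i j).1)

/-- A permutation whose only possible non-descents are inside the blocks of `θ`. -/
theorem exists_perm {r : ℕ} (θ : Composition r) : ∃ π : Equiv.Perm (Fin r),
    ∀ ν : Composition r, BlockIncreasing ν π ↔
      ∀ i j, ν.index i = ν.index j → θ.index i = θ.index j := by
  let f : Fin r → (Fin θ.length)ᵒᵈ := fun i => OrderDual.toDual (θ.index i)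
  have hs := (Tuple.eq_sort_iff (f := f) (σ := Tuple.sort f)).1 rfl
  have hinv : ∀ i, Tuple.sort f ((Tuple.sort f)⁻¹ i) = i := fun i =>
    (Tuple.sort f).apply_symm_apply i
  have h1 : ∀ i j, (Tuple.sort f)⁻¹ i < (Tuple.sort f)⁻¹ j → θ.index j ≤ θ.index i := by
    intro i j hij
    have := hs.1 hij.le
    simp only [Function.comp_apply, hinv] at this
    exact OrderDual.toDual_le_toDual.1 this
  have h2 : ∀ i j, i < j → θ.index i = θ.index j →
      (Tuple.sort f)⁻¹ i < (Tuple.sort f)⁻¹ j := by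
    intro i j hij he
    by_contra hc
    rcases lt_or_eq_of_le (not_lt.1 hc) with hlt | heq
    · have := hs.2 _ _ hlt (by simp only [hinv]; exact congrArg OrderDual.toDual he.symm)
      rw [hinv, hinv] at this
      exact absurd hij (not_lt.2 this.le)
    · exact absurd ((Tuple.sort f)⁻¹.injective heq) (ne_of_gt hij)
  refine ⟨(Tuple.sort f)⁻¹, fun ν => ⟨fun H => ?_, fun H i j hij he => h2 i j hij (H i j he)⟩⟩
  have main : ∀ i j, i < j → ν.index i = ν.index j → θ.index i = θ.index j := fun i j hij he =>
    le_antisymm (index_mono θ hij.le) (h1 i j (H i j hij he))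
  intro i j he
  rcases lt_trichotomy i j with hij | rfl | hij
  · exact main i j hij he
  · rfl
  · exact (main j i hij he.symm).symm

theorem descentElt_coeff (R : Type*) [CommRing R] {r : ℕ} (ν : Composition r)
    (π : Equiv.Perm (Fin r)) :
    (descentElt R ν).coeff (MulOpposite.op π) = if BlockIncreasing ν π then 1 else 0 := by
  classical
  unfold descentElt
  simp only [MonoidAlgebra.coeff_sum, Finsupp.finsetSum_apply, MonoidAlgebra.coeff_single,
    Finsupp.single_apply, MulOpposite.op_inj]
  rw [Finset.sum_ite_eq']
  simp

/-- The elements `X^ν` are linearly independent. -/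
theorem descentElt_linearIndependent (R : Type*) [CommRing R] (r : ℕ) :
    LinearIndependent R (fun ν : Composition r => descentElt R ν) := by
  classical
  rw [Fintype.linearIndependent_iff]
  intro a ha
  let s : Composition r → Finset (Fin r × Fin r) := fun ν =>
    Finset.univ.filter fun p => ν.index p.1 = ν.index p.2
  have main : ∀ n, ∀ θ : Composition r, (s θ).card = n → a θ = 0 := by
    intro n
    induction n using Nat.strong_induction_on with
    | _ n ih =>
      intro θ hθ
      obtain ⟨π, hπ⟩ := exists_perm θ
      have h := congrArg (fun x : SymAlgebra R r => x.coeff (MulOpposite.op π)) ha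
      simp only [MonoidAlgebra.coeff_sum, Finsupp.finsetSum_apply, MonoidAlgebra.coeff_smul,
        Finsupp.smul_apply, descentElt_coeff, MonoidAlgebra.coeff_zero, Finsupp.zero_apply] at h
      rw [Finset.sum_eq_single θ] at h
      · rw [if_pos ((hπ θ).2 fun _ _ h => h)] at h
        simpa using h
      · intro ν _ hν
        by_cases hB : BlockIncreasing ν π
        · have hsub : s ν ⊆ s θ := by
            intro p hp
            simp only [s, Finset.mem_filter, Finset.mem_univ, true_and] at hp ⊢
            exact (hπ ν).1 hB _ _ hp
          have hne : s ν ≠ s θ := by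
            intro he
            apply hν
            apply composition_eq_of_index
            intro i j
            have : (i, j) ∈ s ν ↔ (i, j) ∈ s θ := by rw [he]
            simpa [s] using this
          have hlt := Finset.card_lt_card (Finset.ssubset_iff_subset_ne.2 ⟨hsub, hne⟩)
          rw [ih _ (hθ ▸ hlt) ν rfl, zero_smul]
        · rw [if_neg hB, smul_zero]
      · intro hc
        exact absurd (Finset.mem_univ _) hc
  exact fun θ => main _ θ rfl

theorem one_mem_span_descentElt (R : Type*) [CommRing R] (r : ℕ) :
    (1 : SymAlgebra R r) ∈
      Submodule.span R (Set.range fun ν : Composition r => descentElt R ν) := by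
  classical
  obtain ⟨θ, hθ⟩ := exists_composition (fun _ : Fin r => (0 : ℕ)) monotone_const
  have : (1 : SymAlgebra R r) = descentElt R θ := by
    unfold descentElt
    have h1 : (Finset.univ.filter (BlockIncreasing θ) : Finset (Equiv.Perm (Fin r))) = {1} := by
      ext σ
      simp only [Finset.mem_filter, Finset.mem_univ, true_and, Finset.mem_singleton]
      constructor
      · intro h
        rw [← Equiv.Perm.monotone_iff]
        intro i j hij
        rcases hij.lt_or_eq with hlt | rfl
        · exact (h i j hlt ((hθ i j).2 rfl)).le
        · exact le_rfl
      · rintro rfl i j hij _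
        exact hij
    rw [h1, Finset.sum_singleton]
    rfl
  rw [this]
  exact Submodule.subset_span ⟨θ, rfl⟩

/-- The span of the `X^ν` is closed under multiplication (Solomon). -/
theorem descentElt_mul_mem (R : Type*) [CommRing R] {r : ℕ} (ν μ : Composition r) :
    descentElt R ν * descentElt R μ ∈
      Submodule.span R (Set.range fun ν : Composition r => descentElt R ν) := by
  classical
  let A : Finset (Equiv.Perm (Fin r) × Equiv.Perm (Fin r)) :=
    (Finset.univ.filter (BlockIncreasing ν)) ×ˢ (Finset.univ.filter (BlockIncreasing μ))
  have hA : ∀ p, p ∈ A ↔ BlockIncreasing ν p.1 ∧ BlockIncreasing μ p.2 := by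
    intro p
    simp [A, Finset.mem_product]
  have hprod : descentElt R ν * descentElt R μ =
      ∑ p ∈ A, MonoidAlgebra.single (MulOpposite.op (p.2 * p.1)) (1 : R) := by
    unfold descentElt
    rw [Finset.sum_mul_sum, ← Finset.sum_product']
    refine Finset.sum_congr rfl fun p _ => ?_
    rw [MonoidAlgebra.single_mul_single, mul_one, MulOpposite.op_mul]
  let F : Equiv.Perm (Fin r) × Equiv.Perm (Fin r) → (Fin r → Fin μ.length) := fun p i =>
    μ.index (p.1 i)
  rw [hprod, ← Finset.sum_fiberwise_of_maps_to (s := A) (t := A.image F)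
    (g := F) (fun p hp => Finset.mem_image_of_mem F hp)]
  refine Submodule.sum_mem _ fun f hf => ?_
  obtain ⟨⟨τ₀, σ₀⟩, hp₀, hF₀⟩ := Finset.mem_image.1 hf
  have hτ₀ : BlockIncreasing ν τ₀ := ((hA _).1 hp₀).1
  have hf₀ : ∀ i, μ.index (τ₀ i) = f i := fun i => congrFun hF₀ i
  have hfmono : ∀ i j, i < j → ν.index i = ν.index j → f i ≤ f j := by
    intro i j hij he
    rw [← hf₀, ← hf₀]
    exact index_mono μ (hτ₀ i j hij he).le
  obtain ⟨θ, hθ⟩ := exists_composition (fun i : Fin r => toLex (ν.index i, f i)) (by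
    intro i j hij
    rcases hij.lt_or_eq with hlt | rfl
    · rw [Prod.Lex.toLex_le_toLex]
      rcases (index_mono ν hij).lt_or_eq with h1 | h1
      · exact Or.inl h1
      · exact Or.inr ⟨h1, hfmono i j hlt h1⟩
    · exact le_rfl)
  have hθ' : ∀ i j, θ.index i = θ.index j ↔ ν.index i = ν.index j ∧ f i = f j := by
    intro i j
    rw [hθ]
    simp [Prod.ext_iff]
  have hsort : ∀ τ σ : Equiv.Perm (Fin r), BlockIncreasing μ σ → (∀ i, μ.index (τ i) = f i) →
      σ = Tuple.sort (fun i => f ((σ * τ)⁻¹ i)) := by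
    intro τ σ hσ hτ
    have hval : ∀ i, f ((σ * τ)⁻¹ (σ i)) = μ.index i := by
      intro i
      rw [← hτ]
      simp [mul_inv_rev]
    rw [Tuple.eq_sort_iff]
    constructor
    · intro i j hij
      simp only [Function.comp_apply, hval]
      exact index_mono μ hij
    · intro i j hij he
      simp only [hval] at he
      exact hσ i j hij he
  suffices h : ∑ p ∈ A with F p = f,
      MonoidAlgebra.single (MulOpposite.op (p.2 * p.1)) (1 : R) = descentElt R θ by
    rw [h]
    exact Submodule.subset_span ⟨θ, rfl⟩
  unfold descentElt
  refine Finset.sum_bij (fun p _ => p.2 * p.1) ?_ ?_ ?_ (fun _ _ => rfl)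
  · rintro ⟨τ, σ⟩ hp
    simp only [Finset.mem_filter, hA, Finset.mem_univ, true_and] at hp ⊢
    obtain ⟨⟨hτ, hσ⟩, hF⟩ := hp
    intro i j hij he
    obtain ⟨h1, h2⟩ := (hθ' i j).1 he
    refine hσ _ _ (hτ i j hij h1) ?_
    have hi : μ.index (τ i) = f i := congrFun hF i
    have hj : μ.index (τ j) = f j := congrFun hF j
    rw [hi, hj, h2]
  · rintro ⟨τ, σ⟩ hp ⟨τ', σ'⟩ hp' he
    simp only [Finset.mem_filter, hA] at hp hp' he
    have h1 := hsort τ σ hp.1.2 (fun i => congrFun hp.2 i)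
    have h2 := hsort τ' σ' hp'.1.2 (fun i => congrFun hp'.2 i)
    have hσ : σ = σ' := by rw [h1, h2, he]
    subst hσ
    have := mul_left_cancel he
    rw [this]
  · intro π hπ
    simp only [Finset.mem_filter, Finset.mem_univ, true_and] at hπ
    obtain ⟨σ, hσdef⟩ : ∃ σ, σ = Tuple.sort (fun i => f (π⁻¹ i)) := ⟨_, rfl⟩
    obtain ⟨hs1, hs2⟩ := Tuple.eq_sort_iff.1 hσdef
    have heq : (fun i => f (π⁻¹ (σ i))) = μ.index := by
      have hu := Tuple.unique_monotone (f := f) (σ := π⁻¹ * σ) (τ := τ₀⁻¹) hs1 (by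
        intro i j hij
        simp only [Function.comp_apply, ← hf₀, perm_apply_inv]
        exact index_mono μ hij)
      funext i
      have := congrFun hu i
      simp only [Function.comp_apply, Equiv.Perm.mul_apply] at this
      rw [this, ← hf₀, perm_apply_inv]
    have hσ : BlockIncreasing μ σ := by
      intro i j hij he
      refine hs2 i j hij ?_
      rw [← heq] at he
      exact he
    have hτf : ∀ i, μ.index ((σ⁻¹ * π) i) = f i := by
      intro i
      rw [← heq]
      simp
    refine ⟨(σ⁻¹ * π, σ), ?_, by simp⟩
    simp only [Finset.mem_filter, hA]
    refine ⟨⟨?_, hσ⟩, funext hτf⟩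
    intro i j hij he
    by_contra hc
    have hle : (σ⁻¹ * π) j ≤ (σ⁻¹ * π) i := not_lt.1 hc
    have hfe : f i = f j := by
      refine le_antisymm (hfmono i j hij he) ?_
      rw [← hτf, ← hτf]
      exact index_mono μ hle
    have hlt : (σ⁻¹ * π) j < (σ⁻¹ * π) i :=
      lt_of_le_of_ne hle fun h => (ne_of_gt hij) ((σ⁻¹ * π).injective h)
    have h1 := hσ _ _ hlt (by rw [hτf, hτf, hfe])
    have h2 := hπ i j hij ((hθ' i j).2 ⟨he, hfe⟩)
    simp only [Equiv.Perm.mul_apply, perm_apply_inv] at h1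
    exact absurd h1 (not_lt.2 h2.le)

/-- The descent algebra `D_{r,R}`: the subalgebra of `R Sym(r)` with `R`-basis the `X^ν`. -/
noncomputable def descentAlgebra (R : Type*) [CommRing R] (r : ℕ) :
    Subalgebra R (SymAlgebra R r) :=
  (Submodule.span R (Set.range fun ν : Composition r => descentElt R ν)).toSubalgebra
    (one_mem_span_descentElt R r) (fun x y hx hy => by
      have h := Submodule.mul_mem_mul hx hy
      rw [Submodule.span_mul_span] at h
      refine Submodule.span_le.2 ?_ h
      rintro _ ⟨_, ⟨ν, rfl⟩, _, ⟨μ, rfl⟩, rfl⟩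
      exact descentElt_mul_mem R ν μ)

/-- The `R`-basis `X^ν` of `D_{r,R}`, indexed by the compositions `ν` of `r`. -/
noncomputable def descentBasis (R : Type*) [CommRing R] (r : ℕ) :
    Module.Basis (Composition r) R (descentAlgebra R r) :=
  Module.Basis.span (descentElt_linearIndependent R r)

theorem descentBasis_apply (R : Type*) [CommRing R] {r : ℕ} (ν : Composition r) :
    (descentBasis R r ν : SymAlgebra R r) = descentElt R ν :=
  congrArg Subtype.val (Module.Basis.span_apply (descentElt_linearIndependent R r) ν)

/-! ### Young characters and the map `c_{r,R}` -/

/-- The Young subgroup `Sym(ν₁) × ⋯ × Sym(ν_k)` of `Sym(r)`: the permutations preserving each of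
the consecutive blocks of lengths `ν₁, …, ν_k`. -/
def youngSubgroup {r : ℕ} (ν : Composition r) : Subgroup (Equiv.Perm (Fin r)) where
  carrier := {σ | ∀ i, ν.index (σ i) = ν.index i}
  one_mem' _ := rfl
  mul_mem' {σ τ} hσ hτ i := by
    rw [Equiv.Perm.mul_apply, hσ, hτ]
  inv_mem' {σ} hσ i := by
    rw [← hσ (σ⁻¹ i), perm_apply_inv]

/-- The value at `g` of the character of `G` (in characteristic `0`) induced from the trivial
character of the subgroup `H`: the number of cosets `xH` with `x⁻¹ g x ∈ H`, that is, with
`g x H = x H`. -/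
noncomputable def inducedTrivialCharacter {G : Type*} [Group G] (H : Subgroup G) (g : G) : ℕ :=
  Nat.card {x : G ⧸ H // g • x = x}

/-- The Young character `φ^ν`. -/
noncomputable def youngCharacter {r : ℕ} (ν : Composition r) (σ : Equiv.Perm (Fin r)) : ℕ :=
  inducedTrivialCharacter (youngSubgroup ν) σ

/-- The map `c_{r,R}` from `D_{r,R}` to functions `Sym(r) → R`: the `R`-linear map with
`c_{r,R}(X^ν) = φ^{ν,R}` for all compositions `ν` of `r`. -/
noncomputable def solomonMap (R : Type*) [CommRing R] (r : ℕ) :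
    descentAlgebra R r →ₗ[R] (Equiv.Perm (Fin r) → R) :=
  (descentBasis R r).constr R (fun ν σ => (youngCharacter ν σ : R))

theorem solomonMap_descentBasis (R : Type*) [CommRing R] {r : ℕ} (ν : Composition r) :
    solomonMap R r (descentBasis R r ν) = fun σ => (youngCharacter ν σ : R) :=
  Module.Basis.constr_basis _ _ _ _

end PBWDescent

/-!
The tensor algebra `T(V)` is a cocommutative bialgebra in which the elements of `V`, hence all
elements of `L(V)`, are primitive.  The element `X^ν` acts on `T^r(V)` as the convolution of the
projections of `T(V)` to the degrees `ν₁, …, ν_k`: apply the iterated coproduct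
`T(V) → T(V) ⊗ ⋯ ⊗ T(V)`, project the `j`-th factor to degree `ν_j`, and multiply
(`toTensorAlgebra_descentElt_smul`).

For homogeneous primitive elements `b₁, …, b_l` of degrees `μ₁, …, μ_l`, the coproduct of
`b₁ ⋯ b_l` is a sum over the maps `f` from `{1, …, l}` to `{1, …, k}`, and the projections keep
exactly those `f` for which the `μ_i` with `f i = j` add up to `ν_j`, for all `j`.  The term of `f`
is `b₁ ⋯ b_l` rearranged by the stable sorting of the positions by `f`
(`mulProj_iteratedCoproduct_prod`).  The same formula with all `b_i` in `V` gives the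
description of `X^ν` above, because the stable sortings by such `f` are the permutations with descent
set contained in `{ν₁, ν₁ + ν₂, …}`.

If the `b_i` are Lie elements, exchanging two neighbouring factors changes the product by a product
in which they are merged into their commutator; this replaces two parts of the partition by their
sum, which is lexicographically bigger.  So all rearrangements of an element of `𝒳_λ` agree modulo
`W_{λ+}` (`exists_rearrangement`), and `X^ν` acts on `W_λ / W_{λ+}` as the number of maps `f`.
That number is `φ^ν(λ)`: the cosets of the Young subgroup fixed by `σ` are the colourings of
`{1, …, r}` with `ν_j` points of colour `j` that are constant on the cycles of `σ`
(`youngCharacter_eq_card_weightedMaps`).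
-/

namespace PBWDescent

/-! ### The iterated coproduct and primitive elements -/

section IteratedCoproduct

variable (R : Type*) [CommRing R] (V : Type*) [AddCommGroup V] [Module R V]

/-- The `k`-fold iterated coproduct `T(V) → T(V) ⊗ ⋯ ⊗ T(V)` of the tensor algebra: the algebra
homomorphism under which each `v ∈ V` is primitive. -/
noncomputable def iteratedCoproduct (k : ℕ) :
    TensorAlgebra R V →ₐ[R] ⨂[R] _ : Fin k, TensorAlgebra R V :=
  TensorAlgebra.lift R (∑ j : Fin k,
    (PiTensorProduct.singleAlgHom (R := R) (A := fun _ : Fin k => TensorAlgebra R V) j).toLinearMap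
      ∘ₗ TensorAlgebra.ι R)

/-- `b` is primitive for the `k`-fold iterated coproduct. -/
def IsPrimitive (k : ℕ) (b : TensorAlgebra R V) : Prop :=
  iteratedCoproduct R V k b = ∑ j : Fin k,
    PiTensorProduct.singleAlgHom (R := R) (A := fun _ : Fin k => TensorAlgebra R V) j b

variable {R V}

theorem isPrimitive_ι (k : ℕ) (v : V) : IsPrimitive R V k (TensorAlgebra.ι R v) := by
  unfold IsPrimitive iteratedCoproduct
  rw [TensorAlgebra.lift_ι_apply]
  simp only [LinearMap.sum_apply, LinearMap.comp_apply, AlgHom.toLinearMap_apply]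

theorem commute_singleAlgHom {k : ℕ} {i j : Fin k} (hij : i ≠ j) (a b : TensorAlgebra R V) :
    Commute (PiTensorProduct.singleAlgHom (R := R) (A := fun _ : Fin k => TensorAlgebra R V) i a)
      (PiTensorProduct.singleAlgHom (R := R) (A := fun _ : Fin k => TensorAlgebra R V) j b) := by
  simp only [PiTensorProduct.singleAlgHom_apply]
  exact Commute.tprod (A := fun _ : Fin k => TensorAlgebra R V)
    (Pi.mulSingle_commute (f := fun _ : Fin k => TensorAlgebra R V) hij a b)

section

attribute [local instance] LieRing.ofAssociativeRing

theorem IsPrimitive.commutator {k : ℕ} {a b : TensorAlgebra R V} (ha : IsPrimitive R V k a)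
    (hb : IsPrimitive R V k b) : IsPrimitive R V k (a * b - b * a) := by
  unfold IsPrimitive at *
  rw [map_sub, map_mul, map_mul, ha, hb, Finset.sum_mul_sum, Finset.sum_mul_sum,
    Finset.sum_comm (f := fun i j => PiTensorProduct.singleAlgHom (R := R)
      (A := fun _ : Fin k => TensorAlgebra R V) i b * PiTensorProduct.singleAlgHom (R := R)
      (A := fun _ : Fin k => TensorAlgebra R V) j a),
    ← Finset.sum_sub_distrib]
  refine Finset.sum_congr rfl fun i _ => ?_
  rw [← Finset.sum_sub_distrib, Finset.sum_eq_single i, map_sub, map_mul, map_mul]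
  · intro j _ hj
    rw [sub_eq_zero]
    exact commute_singleAlgHom hj.symm a b
  · intro h
    exact absurd (Finset.mem_univ i) h

theorem isPrimitive_of_mem_freeLie {b : TensorAlgebra R V} (hb : b ∈ freeLie R V) (k : ℕ) :
    IsPrimitive R V k b := by
  unfold freeLie at hb
  induction hb using LieSubalgebra.lieSpan_induction with
  | mem x h =>
    obtain ⟨v, rfl⟩ := h
    exact isPrimitive_ι k v
  | zero => simp only [IsPrimitive, map_zero, Finset.sum_const_zero]
  | add x y _ _ hx hy =>
    unfold IsPrimitive at *
    simp only [map_add, Finset.sum_add_distrib, hx, hy]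
  | smul a x _ hx =>
    unfold IsPrimitive at *
    simp only [map_smul, hx, Finset.smul_sum]
  | lie x y _ _ hx hy =>
    rw [LieRing.of_associative_ring_bracket]
    exact hx.commutator hy

end

/-- Elements placed in different tensor factors commute, so a product of elements placed in the
factors `f i` is a pure tensor, in whose `j`-th factor the order of the product is kept. -/
theorem prod_map_singleAlgHom {k : ℕ} {α : Type*} (L : List α) (f : α → Fin k)
    (b : α → TensorAlgebra R V) :
    (L.map fun i => PiTensorProduct.singleAlgHom (R := R)
      (A := fun _ : Fin k => TensorAlgebra R V) (f i) (b i)).prod =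
    PiTensorProduct.tprod R (fun j => ((L.filter (f · = j)).map b).prod) := by
  induction L with
  | nil => rfl
  | cons a L ih =>
    rw [List.map_cons, List.prod_cons, ih, PiTensorProduct.singleAlgHom_apply,
      PiTensorProduct.tprod_mul_tprod]
    congr 1
    funext j
    by_cases h : f a = j
    · subst h
      simp
    · simp [h]

theorem iteratedCoproduct_prod {k l : ℕ} {b : Fin l → TensorAlgebra R V}
    (hb : ∀ i, IsPrimitive R V k (b i)) :
    iteratedCoproduct R V k (List.ofFn b).prod = ∑ f : Fin l → Fin k,
      PiTensorProduct.tprod R (fun j => (((List.finRange l).filter (f · = j)).map b).prod) := by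
  have h : List.map (iteratedCoproduct R V k) (List.ofFn b) = List.ofFn (fun i => ∑ j : Fin k,
      PiTensorProduct.singleAlgHom (R := R) (A := fun _ : Fin k => TensorAlgebra R V) j (b i)) := by
    rw [List.map_ofFn]
    exact congrArg List.ofFn (funext hb)
  rw [map_list_prod, h, ← MultilinearMap.mkPiAlgebraFin_apply (R := R), MultilinearMap.map_sum]
  refine Finset.sum_congr rfl fun f _ => ?_
  rw [MultilinearMap.mkPiAlgebraFin_apply, List.ofFn_eq_map, prod_map_singleAlgHom]

/-! ### Sorting words -/

/-- `Tuple.sort f` lists the positions `a` in the lexicographic order of the pairs `(f a, a)`. -/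
theorem strictMono_sort {l : ℕ} {α : Type*} [LinearOrder α] (f : Fin l → α) :
    StrictMono fun i => toLex (f (Tuple.sort f i), Tuple.sort f i) := by
  obtain ⟨h1, h2⟩ := (Tuple.eq_sort_iff (f := f) (σ := Tuple.sort f)).1 rfl
  intro i j hij
  rw [Prod.Lex.toLex_lt_toLex]
  rcases (h1 hij.le).lt_or_eq with h | h
  · exact Or.inl h
  · exact Or.inr ⟨h, h2 i j hij h⟩

/-- Concatenating the level sets of `f` gives the stable sorting of the positions by `f`. -/
theorem flatMap_filter_eq_ofFn_sort {k l : ℕ} (f : Fin l → Fin k) :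
    (List.finRange k).flatMap (fun j => (List.finRange l).filter (f · = j)) =
      List.ofFn (Tuple.sort f) := by
  let lt : Fin l → Fin l → Prop := fun a b => toLex (f a, a) < toLex (f b, b)
  have h1 : ((List.finRange k).flatMap
      (fun j => (List.finRange l).filter (f · = j))).Pairwise lt := by
    rw [List.pairwise_flatMap]
    refine ⟨fun j _ => ?_, ?_⟩
    · refine ((List.pairwise_lt_finRange l).filter _).imp_of_mem ?_
      intro a b ha hb hab
      simp only [List.mem_filter, decide_eq_true_eq] at ha hb
      exact Prod.Lex.toLex_lt_toLex.2 (Or.inr ⟨ha.2.trans hb.2.symm, hab⟩)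
    · refine (List.pairwise_lt_finRange k).imp ?_
      intro a b hab x hx y hy
      simp only [List.mem_filter, decide_eq_true_eq] at hx hy
      refine Prod.Lex.toLex_lt_toLex.2 (Or.inl ?_)
      simp only [hx.2, hy.2]
      exact hab
  have h2 : (List.ofFn (Tuple.sort f)).Pairwise lt :=
    List.pairwise_ofFn.2 fun _ _ hij => strictMono_sort f hij
  have hirr : ∀ {a b}, lt a b → a ≠ b := by
    rintro a b h rfl
    exact lt_irrefl _ h
  refine List.Perm.eq_of_pairwise (fun a b _ _ hab hba => absurd hba (lt_asymm hab)) h1 h2 ?_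
  rw [List.perm_ext_iff_of_nodup (h1.imp hirr) (h2.imp hirr)]
  intro a
  simp only [List.mem_flatMap, List.mem_filter, List.mem_finRange, true_and, decide_eq_true_eq,
    exists_eq', List.mem_ofFn, true_iff]
  exact (Tuple.sort f).surjective a

/-! ### Convolution of the homogeneous projections -/

variable (R V)

/-- The linear map `T(V) ⊗ ⋯ ⊗ T(V) → T(V)` which projects the `j`-th factor to its component of
degree `d j` and then multiplies the factors in order. -/
noncomputable def mulProj {k : ℕ} (d : Fin k → ℕ) :
    (⨂[R] _ : Fin k, TensorAlgebra R V) →ₗ[R] TensorAlgebra R V :=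
  PiTensorProduct.lift ((MultilinearMap.mkPiAlgebraFin R k (TensorAlgebra R V)).compLinearMap
    fun j => GradedAlgebra.proj
      (fun n : ℕ => LinearMap.range (TensorAlgebra.ι R (M := V)) ^ n) (d j))

variable {R V}

theorem mulProj_tprod {k : ℕ} (d e : Fin k → ℕ) (a : Fin k → TensorAlgebra R V)
    (ha : ∀ j, a j ∈ LinearMap.range (TensorAlgebra.ι R (M := V)) ^ e j) :
    mulProj R V d (PiTensorProduct.tprod R a) = if e = d then (List.ofFn a).prod else 0 := by
  unfold mulProj
  rw [PiTensorProduct.lift.tprod, MultilinearMap.compLinearMap_apply,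
    MultilinearMap.mkPiAlgebraFin_apply]
  split_ifs with h
  · subst h
    congr 2
    funext j
    exact DirectSum.decompose_of_mem_same _ (ha j)
  · obtain ⟨j, hj⟩ := Function.ne_iff.1 h
    refine List.prod_eq_zero (List.mem_ofFn.2 ⟨j, ?_⟩)
    exact DirectSum.decompose_of_mem_ne
      (fun n : ℕ => LinearMap.range (TensorAlgebra.ι R (M := V)) ^ n) (ha j) hj

/-- The maps `f : ι → {1, …, k}` whose fibre over each `j` has total weight `d j`, where `i : ι` has
weight `m i`. -/
def weightedMaps {ι : Type*} [Fintype ι] [DecidableEq ι] {k : ℕ} (m : ι → ℕ) (d : Fin k → ℕ) :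
    Finset (ι → Fin k) :=
  Finset.univ.filter fun f => ∀ j, ∑ i with f i = j, m i = d j

/-- The convolution of homogeneous projections sends a product of homogeneous primitive elements to
the sum of its rearrangements along all weighted maps. -/
theorem mulProj_iteratedCoproduct_prod {k l : ℕ} (d : Fin k → ℕ) {m : Fin l → ℕ}
    {b : Fin l → TensorAlgebra R V} (hb : ∀ i, IsPrimitive R V k (b i))
    (hm : ∀ i, b i ∈ LinearMap.range (TensorAlgebra.ι R (M := V)) ^ m i) :
    mulProj R V d (iteratedCoproduct R V k (List.ofFn b).prod) =
      ∑ f ∈ weightedMaps m d, (List.ofFn (b ∘ Tuple.sort f)).prod := by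
  rw [iteratedCoproduct_prod hb, map_sum, weightedMaps, Finset.sum_filter]
  refine Finset.sum_congr rfl fun f _ => ?_
  rw [mulProj_tprod d (fun j => (((List.finRange l).filter (f · = j)).map m).sum) _
    (fun j => SetLike.list_prod_map_mem_graded
      (A := fun n : ℕ => LinearMap.range (TensorAlgebra.ι R (M := V)) ^ n) _ m b fun i _ => hm i)]
  have hsum : ∀ j, (((List.finRange l).filter (f · = j)).map m).sum = ∑ i with f i = j, m i := by
    intro j
    rw [← List.sum_toFinset _ ((List.nodup_finRange l).filter _)]
    refine Finset.sum_congr ?_ fun _ _ => rfl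
    ext i
    simp
  have hprod : (List.ofFn fun j => (((List.finRange l).filter (f · = j)).map b).prod).prod =
      (List.ofFn (b ∘ Tuple.sort f)).prod := by
    rw [← List.map_ofFn, ← flatMap_filter_eq_ofFn_sort, List.map_flatMap, List.flatMap,
      List.prod_flatten, List.map_map, List.ofFn_eq_map]
    rfl
  simp only [funext_iff, hsum, hprod]

end IteratedCoproduct

/-! ### The descent algebra acts by convolution -/

section DescentAction

theorem card_filter_index_eq {r : ℕ} (ν : Composition r) (j : Fin ν.length) :
    (Finset.univ.filter fun i => ν.index i = j).card = ν.blocksFun j := by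
  have h : (Finset.univ.filter fun i => ν.index i = j) =
      Finset.univ.map (ν.embedding j).toEmbedding := by
    ext i
    have := ν.mem_range_embedding_iff' (j := i) (i := j)
    simp only [Set.mem_range] at this
    simp only [Finset.mem_filter, Finset.mem_univ, true_and, Finset.mem_map,
      RelEmbedding.coe_toEmbedding]
    rw [this, eq_comm]
  rw [h, Finset.card_map, Finset.card_univ, Fintype.card_fin]

theorem mem_weightedMaps {ι : Type*} [Fintype ι] [DecidableEq ι] {k : ℕ} {m : ι → ℕ}
    {d : Fin k → ℕ} {f : ι → Fin k} :
    f ∈ weightedMaps m d ↔ ∀ j, ∑ i with f i = j, m i = d j := by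
  simp [weightedMaps]

theorem mem_weightedMaps_one {ι : Type*} [Fintype ι] [DecidableEq ι] {k : ℕ} {d : Fin k → ℕ}
    {f : ι → Fin k} :
    f ∈ weightedMaps (fun _ => 1) d ↔ ∀ j, (Finset.univ.filter fun i => f i = j).card = d j := by
  simp [mem_weightedMaps]

theorem exists_equiv_of_card_fiber_eq {α β γ : Type*} [Fintype α] [Fintype β] [DecidableEq γ]
    {f : α → γ} {g : β → γ}
    (h : ∀ c, (Finset.univ.filter fun a => f a = c).card =
      (Finset.univ.filter fun b => g b = c).card) :
    ∃ e : α ≃ β, ∀ a, g (e a) = f a := by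
  have e : ∀ c, Nonempty ({a // f a = c} ≃ {b // g b = c}) := fun c => by
    rw [← Fintype.card_eq, Fintype.card_subtype, Fintype.card_subtype, h c]
  exact ⟨Equiv.ofFiberEquiv fun c => (e c).some, fun a => Equiv.ofFiberEquiv_map _ a⟩

theorem index_comp_mem_weightedMaps {r : ℕ} (ν : Composition r) (τ : Equiv.Perm (Fin r)) :
    (fun i => ν.index (τ i)) ∈ weightedMaps (fun _ => 1) ν.blocksFun := by
  rw [mem_weightedMaps_one]
  intro j
  rw [← card_filter_index_eq]
  exact Finset.card_equiv τ (by simp)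

theorem exists_eq_index_comp {r : ℕ} {ν : Composition r} {f : Fin r → Fin ν.length}
    (hf : f ∈ weightedMaps (fun _ => 1) ν.blocksFun) :
    ∃ τ : Equiv.Perm (Fin r), ∀ i, f i = ν.index (τ i) := by
  obtain ⟨e, he⟩ := exists_equiv_of_card_fiber_eq (f := f) (g := ν.index) fun c => by
    rw [mem_weightedMaps_one.1 hf, card_filter_index_eq]
  exact ⟨e, fun i => (he i).symm⟩

/-- A colouring with the block sizes of `ν` becomes the block colouring of `ν` when sorted. -/
theorem comp_sort_eq_index {r : ℕ} {ν : Composition r} {f : Fin r → Fin ν.length}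
    (hf : f ∈ weightedMaps (fun _ => 1) ν.blocksFun) (i : Fin r) :
    f (Tuple.sort f i) = ν.index i := by
  obtain ⟨τ, hτ⟩ := exists_eq_index_comp hf
  have h := Tuple.unique_monotone (f := f) (σ := Tuple.sort f) (τ := τ⁻¹) (Tuple.monotone_sort f)
    (by
      intro i j hij
      simp only [Function.comp_apply, hτ, perm_apply_inv]
      exact index_mono ν hij)
  have := congrFun h i
  simpa only [Function.comp_apply, hτ, perm_apply_inv] using this

theorem blockIncreasing_sort {r : ℕ} {ν : Composition r} {f : Fin r → Fin ν.length}
    (hf : f ∈ weightedMaps (fun _ => 1) ν.blocksFun) : BlockIncreasing ν (Tuple.sort f) := by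
  intro i j hij he
  refine ((Tuple.eq_sort_iff (f := f) (σ := Tuple.sort f)).1 rfl).2 i j hij ?_
  rw [comp_sort_eq_index hf, comp_sort_eq_index hf, he]

theorem BlockIncreasing.sort_index_comp_inv {r : ℕ} {ν : Composition r} {σ : Equiv.Perm (Fin r)}
    (hσ : BlockIncreasing ν σ) : Tuple.sort (fun i => ν.index (σ⁻¹ i)) = σ := by
  symm
  rw [Tuple.eq_sort_iff]
  constructor
  · intro i j hij
    simpa using index_mono ν hij
  · intro i j hij he
    exact hσ i j hij (by simpa using he)

variable {R : Type*} [CommRing R] {V : Type*} [AddCommGroup V] [Module R V]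

/-- `X^ν` acts on `T^r(V)` as the convolution of the projections to the degrees `ν₁, …, ν_k`. -/
theorem toTensorAlgebra_descentElt_smul {r : ℕ} (ν : Composition r) (t : ⨂[R]^r V) :
    TensorPower.toTensorAlgebra (descentElt R ν • t) =
      mulProj R V ν.blocksFun (iteratedCoproduct R V ν.length (TensorPower.toTensorAlgebra t)) := by
  let A : (⨂[R]^r V) →ₗ[R] TensorAlgebra R V :=
    TensorPower.toTensorAlgebra ∘ₗ (placePerm R V r).asAlgebraHom (descentElt R ν)
  let B : (⨂[R]^r V) →ₗ[R] TensorAlgebra R V :=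
    mulProj R V ν.blocksFun ∘ₗ (iteratedCoproduct R V ν.length).toLinearMap ∘ₗ
      TensorPower.toTensorAlgebra
  suffices h : A = B from LinearMap.congr_fun h t
  refine PiTensorProduct.ext (MultilinearMap.ext fun v => ?_)
  simp only [LinearMap.compMultilinearMap_apply, A, B, LinearMap.comp_apply,
    AlgHom.toLinearMap_apply, TensorPower.toTensorAlgebra_tprod, TensorAlgebra.tprod_apply]
  rw [mulProj_iteratedCoproduct_prod ν.blocksFun (m := fun _ => 1)
    (fun i => isPrimitive_ι ν.length (v i)) (fun i => by simp)]
  unfold descentElt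
  simp only [map_sum, LinearMap.sum_apply, Representation.asAlgebraHom_single, one_smul,
    placePerm_tprod, TensorPower.toTensorAlgebra_tprod, TensorAlgebra.tprod_apply]
  refine Finset.sum_nbij' (fun σ i => ν.index (σ⁻¹ i)) (fun f => Tuple.sort f) ?_ ?_ ?_ ?_ ?_
  · intro σ _
    exact index_comp_mem_weightedMaps ν σ⁻¹
  · intro f hf
    simpa using blockIncreasing_sort hf
  · intro σ hσ
    exact (Finset.mem_filter.1 hσ).2.sort_index_comp_inv
  · intro f hf
    funext i
    rw [← comp_sort_eq_index hf, perm_apply_inv]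
  · intro σ hσ
    simp only [(Finset.mem_filter.1 hσ).2.sort_index_comp_inv]
    rfl

end DescentAction

/-! ### Merging parts of a partition -/

section Lexicographic

theorem sort_cons_eq_orderedInsert (a : ℕ) (s : Multiset ℕ) :
    (a ::ₘ s).sort (· ≥ ·) = (s.sort (· ≥ ·)).orderedInsert (· ≥ ·) a := by
  refine List.Perm.eq_of_pairwise (le := (· ≥ ·)) (fun _ _ _ _ h h' => le_antisymm h' h)
    (Multiset.pairwise_sort _ _) ((Multiset.pairwise_sort s (· ≥ ·)).orderedInsert a _) ?_
  rw [← Multiset.coe_eq_coe, Multiset.sort_eq, Multiset.coe_eq_coe.2 (List.perm_orderedInsert _ _ _),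
    ← Multiset.cons_coe, Multiset.sort_eq]

/-- Inserting a number into a non-increasing list gives a lexicographically bigger list than inserting
two smaller numbers. -/
theorem orderedInsert_orderedInsert_lt {a b c : ℕ} (ha : a < c) (hb : b < c) (l : List ℕ)
    (hl : l.Pairwise (· ≥ ·)) :
    (l.orderedInsert (· ≥ ·) b).orderedInsert (· ≥ ·) a < l.orderedInsert (· ≥ ·) c := by
  induction l with
  | nil =>
    simp only [List.orderedInsert]
    split_ifs <;> exact List.cons_lt_cons_iff.2 (Or.inl (by assumption))
  | cons h t ih =>
    have iht := ih hl.of_cons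
    rcases lt_or_ge h c with hc | hc
    · simp only [List.orderedInsert, ge_iff_le, if_pos hc.le]
      split_ifs <;> simp only [List.orderedInsert] <;> split_ifs <;>
        exact List.cons_lt_cons_iff.2 (Or.inl (by assumption))
    · -- `h` is the head of both lists, also when `c = h`, where `c` is inserted before `h`
      have h1 : (h :: t).orderedInsert (· ≥ ·) c = h :: t.orderedInsert (· ≥ ·) c := by
        rcases hc.lt_or_eq with hlt | rfl
        · simp [List.orderedInsert, hlt]
        · rw [List.orderedInsert, if_pos le_rfl]
          cases t with
          | nil => rfl
          | cons h' t' =>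
            rw [List.orderedInsert, if_pos (List.rel_of_pairwise_cons hl List.mem_cons_self)]
      have ha' : ¬ h ≤ a := by omega
      have hb' : ¬ h ≤ b := by omega
      rw [h1]
      simp only [List.orderedInsert, ge_iff_le, if_neg ha', if_neg hb']
      exact List.cons_lt_cons_iff.2 (Or.inr ⟨rfl, iht⟩)

/-- Merging two parts of a partition makes it lexicographically bigger. -/
theorem sort_lt_sort_merge {a b : ℕ} (ha : 0 < a) (hb : 0 < b) (s : Multiset ℕ) :
    (a ::ₘ b ::ₘ s).sort (· ≥ ·) < ((a + b) ::ₘ s).sort (· ≥ ·) := by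
  rw [sort_cons_eq_orderedInsert, sort_cons_eq_orderedInsert, sort_cons_eq_orderedInsert]
  exact orderedInsert_orderedInsert_lt (by omega) (by omega) _ (Multiset.pairwise_sort _ _)

end Lexicographic

/-! ### Rearranging products of Lie elements -/

section Filtration

variable {R : Type*} [CommRing R] {V : Type*} [AddCommGroup V] [Module R V]

theorem toTensorAlgebra_injective (r : ℕ) :
    Function.Injective (TensorPower.toTensorAlgebra : (⨂[R]^r V) →ₗ[R] TensorAlgebra R V) := by
  have h : ∀ t : ⨂[R]^r V, TensorAlgebra.toDirectSum (TensorPower.toTensorAlgebra t) =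
      DirectSum.of (fun n => ⨂[R]^n V) r t := by
    intro t
    rw [← TensorAlgebra.toDirectSum_ofDirectSum (DirectSum.of (fun n => ⨂[R]^n V) r t)]
    congr 1
    exact (DirectSum.toAddMonoid_of
      (fun _ ↦ LinearMap.toAddMonoidHom TensorPower.toTensorAlgebra) _ _).symm
  intro t t' he
  apply DirectSum.of_injective (β := fun n => ⨂[R]^n V) r
  rw [← h, ← h, he]

theorem exists_toTensorAlgebra_eq {r : ℕ} {x : TensorAlgebra R V}
    (hx : x ∈ LinearMap.range (TensorAlgebra.ι R (M := V)) ^ r) :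
    ∃ t : ⨂[R]^r V, TensorPower.toTensorAlgebra t = x := by
  suffices h : LinearMap.range (TensorAlgebra.ι R (M := V)) ^ r ≤
      LinearMap.range (TensorPower.toTensorAlgebra : (⨂[R]^r V) →ₗ[R] TensorAlgebra R V) from h hx
  rw [Submodule.pow_eq_span_pow_set, Submodule.span_le]
  intro y hy
  obtain ⟨f, rfl⟩ := Set.mem_pow.1 hy
  choose v hv using fun i => (f i).2
  refine ⟨PiTensorProduct.tprod R v, ?_⟩
  rw [TensorPower.toTensorAlgebra_tprod, TensorAlgebra.tprod_apply]
  simp only [hv]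

section

attribute [local instance] LieRing.ofAssociativeRing

theorem commutator_mem_liePower {i j : ℕ} {a b : TensorAlgebra R V} (ha : a ∈ liePower R V i)
    (hb : b ∈ liePower R V j) : a * b - b * a ∈ liePower R V (i + j) := by
  refine ⟨Submodule.sub_mem _ ?_ ?_, ?_⟩
  · rw [pow_add]
    exact Submodule.mul_mem_mul ha.1 hb.1
  · rw [add_comm, pow_add]
    exact Submodule.mul_mem_mul hb.1 ha.1
  · rw [← LieRing.of_associative_ring_bracket]
    exact (freeLie R V).lie_mem ha.2 hb.2

end

/-- The members of the list `L` are pairs of a positive degree and a Lie element of that degree. -/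
def IsLieWord (L : List (ℕ × TensorAlgebra R V)) : Prop :=
  ∀ p ∈ L, 0 < p.1 ∧ p.2 ∈ liePower R V p.1

theorem IsLieWord.prod_mem {L : List (ℕ × TensorAlgebra R V)} (hL : IsLieWord L) :
    (L.map Prod.snd).prod ∈
      LinearMap.range (TensorAlgebra.ι R (M := V)) ^ (L.map Prod.fst).sum :=
  SetLike.list_prod_map_mem_graded
    (A := fun n : ℕ => LinearMap.range (TensorAlgebra.ι R (M := V)) ^ n) L Prod.fst Prod.snd
    fun p hp => (hL p hp).2.1

theorem IsLieWord.mem_pbwProducts {L : List (ℕ × TensorAlgebra R V)} (hL : IsLieWord L) {r : ℕ}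
    {θ : r.Partition} (hθ : (L.map Prod.fst : Multiset ℕ) = θ.parts) {t : ⨂[R]^r V}
    (ht : TensorPower.toTensorAlgebra t = (L.map Prod.snd).prod) : t ∈ pbwProducts R V θ := by
  let μ : Composition r :=
    { blocks := L.map Prod.fst
      blocks_pos := by
        intro i hi
        obtain ⟨p, hp, rfl⟩ := List.mem_map.1 hi
        exact (hL p hp).1
      blocks_sum := by rw [← θ.parts_sum, ← hθ, Multiset.sum_coe] }
  have hlen : μ.length = L.length := List.length_map _
  refine ⟨μ, Nat.Partition.ext hθ, fun i => (L[(i : ℕ)]'(hlen ▸ i.2)).2, fun i => ?_, ?_⟩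
  · have : μ.blocksFun i = (L[(i : ℕ)]'(hlen ▸ i.2)).1 := by
      simp [Composition.blocksFun, μ]
    rw [this]
    exact (hL _ (List.getElem_mem _)).2
  · rw [ht]
    congr 1
    refine List.ext_getElem (by simp [hlen]) fun i h1 h2 => ?_
    simp

/-- Exchanging two neighbouring factors changes a product of Lie elements by a product in which
the two factors are merged into their commutator. -/
theorem IsLieWord.prod_swap_sub_mem {P L : List (ℕ × TensorAlgebra R V)}
    {x y : ℕ × TensorAlgebra R V} (hL : IsLieWord (P ++ x :: y :: L)) {r : ℕ} {lam : r.Partition}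
    (hlam : ((P ++ x :: y :: L).map Prod.fst : Multiset ℕ) = lam.parts) :
    ((P ++ x :: y :: L).map Prod.snd).prod - ((P ++ y :: x :: L).map Prod.snd).prod ∈
      (pbwFiltrationNext R V lam).map TensorPower.toTensorAlgebra := by
  have hx := hL x (by simp)
  have hy := hL y (by simp)
  let M : List (ℕ × TensorAlgebra R V) := P ++ (x.1 + y.1, x.2 * y.2 - y.2 * x.2) :: L
  have hM : IsLieWord M := by
    intro p hp
    rcases List.mem_append.1 hp with h | h
    · exact hL p (by simp [h])
    rcases List.mem_cons.1 h with rfl | h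
    · exact ⟨Nat.add_pos_left hx.1 _, commutator_mem_liePower hx.2 hy.2⟩
    · exact hL p (by simp [h])
  have hsum : (M.map Prod.fst).sum = r := by
    rw [← lam.parts_sum, ← hlam, Multiset.sum_coe]
    simp [M, add_assoc]
  let θ : r.Partition :=
    { parts := (M.map Prod.fst : List ℕ)
      parts_pos := by
        intro i hi
        obtain ⟨p, hp, rfl⟩ := List.mem_map.1 (Multiset.mem_coe.1 hi)
        exact (hM p hp).1
      parts_sum := by rw [Multiset.sum_coe, hsum] }
  have hlt : partList lam < partList θ := by
    have h1 : lam.parts = x.1 ::ₘ y.1 ::ₘ ((P ++ L).map Prod.fst : List ℕ) := by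
      rw [← hlam, Multiset.cons_coe, Multiset.cons_coe, Multiset.coe_eq_coe]
      simp only [List.map_append, List.map_cons]
      exact List.perm_middle.trans (List.perm_middle.cons _)
    have h2 : θ.parts = (x.1 + y.1) ::ₘ ((P ++ L).map Prod.fst : List ℕ) := by
      simp only [θ, M]
      rw [Multiset.cons_coe, Multiset.coe_eq_coe]
      simp only [List.map_append, List.map_cons]
      exact List.perm_middle
    unfold partList
    rw [h1, h2]
    exact sort_lt_sort_merge hx.1 hy.1 _
  obtain ⟨t, ht⟩ := exists_toTensorAlgebra_eq (hsum ▸ hM.prod_mem)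
  refine ⟨t, Submodule.subset_span (Set.mem_iUnion.2 ⟨⟨θ, hlt⟩, hM.mem_pbwProducts rfl ht⟩), ?_⟩
  rw [ht]
  simp only [M, List.map_append, List.map_cons, List.prod_append, List.prod_cons]
  noncomm_ring

theorem IsLieWord.prod_sub_prod_mem_of_perm {r : ℕ} {lam : r.Partition}
    {L L' : List (ℕ × TensorAlgebra R V)} (h : L.Perm L') (P : List (ℕ × TensorAlgebra R V))
    (hL : IsLieWord (P ++ L)) (hlam : ((P ++ L).map Prod.fst : Multiset ℕ) = lam.parts) :
    ((P ++ L).map Prod.snd).prod - ((P ++ L').map Prod.snd).prod ∈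
      (pbwFiltrationNext R V lam).map TensorPower.toTensorAlgebra := by
  induction h generalizing P with
  | nil => simp
  | cons x _ ih => simpa using ih (P ++ [x]) (by simpa using hL) (by simpa using hlam)
  | swap x y l => exact hL.prod_swap_sub_mem hlam
  | trans h₁ _ ih₁ ih₂ =>
    have hp := h₁.append_left P
    rw [← sub_add_sub_cancel]
    refine Submodule.add_mem _ (ih₁ P hL hlam)
      (ih₂ P (fun p hmem => hL p (hp.mem_iff.2 hmem)) ?_)
    rw [← hlam, Multiset.coe_eq_coe]
    exact (hp.map _).symm

/-- Rearranging the factors of an element of `𝒳_λ` gives an element of `𝒳_λ` congruent to it modulo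
`W_{λ+}`. -/
theorem exists_rearrangement {r l : ℕ} {lam : r.Partition} {m : Fin l → ℕ}
    (hpos : ∀ i, 0 < m i) (hlam : (List.ofFn m : Multiset ℕ) = lam.parts)
    {b : Fin l → TensorAlgebra R V} (hb : ∀ i, b i ∈ liePower R V (m i)) {t : ⨂[R]^r V}
    (ht : TensorPower.toTensorAlgebra t = (List.ofFn b).prod) (π : Equiv.Perm (Fin l)) :
    ∃ t' ∈ pbwProducts R V lam, TensorPower.toTensorAlgebra t' = (List.ofFn (b ∘ π)).prod ∧
      t' - t ∈ pbwFiltrationNext R V lam := by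
  let L : List (ℕ × TensorAlgebra R V) := List.ofFn ((fun i => (m i, b i)) ∘ π)
  let L' : List (ℕ × TensorAlgebra R V) := List.ofFn fun i => (m i, b i)
  have hperm : L.Perm L' := Equiv.Perm.ofFn_comp_perm π _
  have hL : IsLieWord L := by
    intro p hp
    obtain ⟨i, rfl⟩ := List.mem_ofFn.1 hp
    exact ⟨hpos _, hb _⟩
  have hfst : (L.map Prod.fst : Multiset ℕ) = lam.parts := by
    rw [← hlam, Multiset.coe_eq_coe]
    refine (hperm.map _).trans (List.Perm.of_eq ?_)
    rw [List.map_ofFn]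
    rfl
  have hsnd : L.map Prod.snd = List.ofFn (b ∘ π) := by
    rw [List.map_ofFn]
    rfl
  have hsnd' : L'.map Prod.snd = List.ofFn b := by
    rw [List.map_ofFn]
    rfl
  have hsum : (L.map Prod.fst).sum = r := by
    rw [← lam.parts_sum, ← hfst, Multiset.sum_coe]
  obtain ⟨t', ht'⟩ := exists_toTensorAlgebra_eq (hsum ▸ hL.prod_mem)
  refine ⟨t', hL.mem_pbwProducts hfst ht', hsnd ▸ ht', ?_⟩
  obtain ⟨u, hu, hut⟩ := IsLieWord.prod_sub_prod_mem_of_perm hperm [] hL hfst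
  rw [List.nil_append, List.nil_append, ← ht', hsnd', ← ht, ← map_sub] at hut
  rwa [← toTensorAlgebra_injective r hut]

end Filtration

/-! ### Young characters count weighted maps -/

section YoungCharacters

theorem card_weightedMaps_congr {ι κ : Type*} [Fintype ι] [DecidableEq ι] [Fintype κ]
    [DecidableEq κ] {k : ℕ} {m : ι → ℕ} {n : κ → ℕ} (d : Fin k → ℕ)
    (h : Finset.univ.val.map m = Finset.univ.val.map n) :
    (weightedMaps m d).card = (weightedMaps n d).card := by
  obtain ⟨e, he⟩ := exists_equiv_of_card_fiber_eq (f := m) (g := n) fun c => by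
    have := congrArg (Multiset.count c) h
    rw [Multiset.count_map, Multiset.count_map] at this
    simpa only [Finset.card_def, Finset.filter_val, eq_comm] using this
  refine Finset.card_equiv (Equiv.arrowCongr e (Equiv.refl _)) fun f => ?_
  rw [mem_weightedMaps, mem_weightedMaps]
  refine forall_congr' fun j => ?_
  have : ∑ i with f i = j, m i = ∑ i with f (e.symm i) = j, n i :=
    Finset.sum_equiv e (by simp) (by simp [he])
  rw [this]
  rfl

/-- The cycles of `σ`, fixed points included. -/
abbrev Cycles {r : ℕ} (σ : Equiv.Perm (Fin r)) : Type :=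
  Quotient (Equiv.Perm.SameCycle.setoid σ)

noncomputable instance {r : ℕ} (σ : Equiv.Perm (Fin r)) : Fintype (Cycles σ) :=
  Fintype.ofFinite _

noncomputable instance {r : ℕ} (σ : Equiv.Perm (Fin r)) : DecidableEq (Cycles σ) :=
  Classical.decEq _

/-- The cycle of `σ` through `x`. -/
def cycleThrough {r : ℕ} (σ : Equiv.Perm (Fin r)) (x : Fin r) : Cycles σ :=
  Quotient.mk _ x

theorem cycleThrough_eq_iff {r : ℕ} {σ : Equiv.Perm (Fin r)} {x y : Fin r} :
    cycleThrough σ x = cycleThrough σ y ↔ σ.SameCycle x y :=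
  Quotient.eq (r := Equiv.Perm.SameCycle.setoid σ)

/-- The length of a cycle of `σ`. -/
noncomputable def cycleLength {r : ℕ} (σ : Equiv.Perm (Fin r)) (w : Cycles σ) : ℕ :=
  (Finset.univ.filter fun x => cycleThrough σ x = w).card

theorem cycleLength_pos {r : ℕ} (σ : Equiv.Perm (Fin r)) (w : Cycles σ) : 0 < cycleLength σ w := by
  obtain ⟨x, rfl⟩ := Quotient.exists_rep w
  exact Finset.card_pos.2 ⟨x, Finset.mem_filter.2 ⟨Finset.mem_univ _, rfl⟩⟩

theorem sum_cycleLength {r : ℕ} (σ : Equiv.Perm (Fin r)) (s : Finset (Cycles σ)) :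
    ∑ w ∈ s, cycleLength σ w = (Finset.univ.filter fun x => cycleThrough σ x ∈ s).card := by
  rw [Finset.card_eq_sum_card_fiberwise (s := Finset.univ.filter fun x => cycleThrough σ x ∈ s)
    (t := s) (f := cycleThrough σ)
    (fun x hx => (Finset.mem_filter.1 (Finset.mem_coe.1 hx)).2)]
  refine Finset.sum_congr rfl fun w hw => ?_
  unfold cycleLength
  congr 1
  ext x
  simp only [Finset.mem_filter, Finset.mem_univ, true_and]
  exact ⟨fun h => ⟨h ▸ hw, h⟩, fun h => h.2⟩

theorem cycleLength_cycleThrough {r : ℕ} {σ : Equiv.Perm (Fin r)} {x : Fin r} (hx : σ x ≠ x) :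
    cycleLength σ (cycleThrough σ x) = (σ.cycleOf x).support.card := by
  unfold cycleLength
  congr 1
  ext y
  rw [Equiv.Perm.mem_support_cycleOf_iff' hx]
  simp only [Finset.mem_filter, Finset.mem_univ, true_and, cycleThrough_eq_iff]
  exact ⟨fun h => h.symm, fun h => h.symm⟩

theorem two_le_cycleLength_cycleThrough {r : ℕ} {σ : Equiv.Perm (Fin r)} {x : Fin r} :
    2 ≤ cycleLength σ (cycleThrough σ x) ↔ σ x ≠ x := by
  constructor
  · intro h hx
    have : cycleLength σ (cycleThrough σ x) ≤ 1 := by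
      refine Finset.card_le_one.2 fun a ha b hb => ?_
      simp only [Finset.mem_filter, Finset.mem_univ, true_and, cycleThrough_eq_iff] at ha hb
      rw [ha.eq_of_right hx, hb.eq_of_right hx]
    omega
  · intro h
    rw [cycleLength_cycleThrough h]
    exact (Equiv.Perm.isCycle_cycleOf σ h).two_le_card_support

/-- The lengths of the cycles form the cycle type, fixed points included. -/
theorem map_cycleLength_eq_parts {r : ℕ} (σ : Equiv.Perm (Fin r)) :
    Finset.univ.val.map (cycleLength σ) = σ.partition.parts := by
  classical
  rw [Equiv.Perm.parts_partition]
  -- nontrivial cycles correspond to the cycle factors of `σ`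
  let c : Cycles σ → Equiv.Perm (Fin r) := Quotient.lift (fun x => σ.cycleOf x)
    fun x y (h : σ.SameCycle x y) => h.cycleOf_eq
  have hc : ∀ x, c (cycleThrough σ x) = σ.cycleOf x := fun _ => rfl
  have hlong : ((Finset.univ.filter fun w => 2 ≤ cycleLength σ w).val.map (cycleLength σ)) =
      σ.cycleType := by
    have himg : (Finset.univ.filter fun w => 2 ≤ cycleLength σ w).image c =
        σ.cycleFactorsFinset := by
      ext p
      simp only [Finset.mem_image, Finset.mem_filter, Finset.mem_univ, true_and]
      constructor
      · rintro ⟨w, hw, rfl⟩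
        obtain ⟨x, rfl⟩ := Quotient.exists_rep w
        exact Equiv.Perm.cycleOf_mem_cycleFactorsFinset_iff.2
          (Equiv.Perm.mem_support.2 (two_le_cycleLength_cycleThrough.1 hw))
      · intro hp
        obtain ⟨x, hx⟩ := (Equiv.Perm.mem_cycleFactorsFinset_iff.1 hp).1.nonempty_support
        have hx' : x ∈ σ.support := Equiv.Perm.mem_cycleFactorsFinset_support_le hp hx
        refine ⟨cycleThrough σ x,
          two_le_cycleLength_cycleThrough.2 (Equiv.Perm.mem_support.1 hx'), ?_⟩
        rw [hc, ← Equiv.Perm.cycle_is_cycleOf hx hp]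
    have hinj : Set.InjOn c (Finset.univ.filter fun w => 2 ≤ cycleLength σ w) := by
      intro w hw w' hw' he
      obtain ⟨x, rfl⟩ := Quotient.exists_rep w
      obtain ⟨y, rfl⟩ := Quotient.exists_rep w'
      simp only [Finset.coe_filter, Finset.mem_univ, true_and, Set.mem_ofPred_eq] at hw hw'
      have hx := two_le_cycleLength_cycleThrough.1 hw
      have hy := two_le_cycleLength_cycleThrough.1 hw'
      have hmem : x ∈ (σ.cycleOf y).support := by
        have : x ∈ (σ.cycleOf x).support := (Equiv.Perm.mem_support_cycleOf_iff' hx).2 (.refl _ _)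
        rwa [show σ.cycleOf x = σ.cycleOf y from he] at this
      exact cycleThrough_eq_iff.2 ((Equiv.Perm.mem_support_cycleOf_iff' hy).1 hmem).symm
    rw [Equiv.Perm.cycleType_def, ← himg, Finset.image_val_of_injOn hinj, Multiset.map_map]
    refine Multiset.map_congr rfl fun w hw => ?_
    obtain ⟨x, rfl⟩ := Quotient.exists_rep w
    exact cycleLength_cycleThrough
      (two_le_cycleLength_cycleThrough.1 (Finset.mem_filter.1 hw).2)
  have hshort : ((Finset.univ.filter fun w => ¬ 2 ≤ cycleLength σ w).val.map (cycleLength σ)) =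
      Multiset.replicate (Fintype.card (Fin r) - σ.support.card) 1 := by
    have hone : ∀ w ∈ Finset.univ.filter (fun w => ¬ 2 ≤ cycleLength σ w),
        cycleLength σ w = 1 := by
      intro w hw
      have h1 := cycleLength_pos σ w
      have h2 := (Finset.mem_filter.1 hw).2
      omega
    rw [Multiset.eq_replicate]
    constructor
    · have hcard : (Finset.univ.filter fun w => ¬ 2 ≤ cycleLength σ w).card = σ.supportᶜ.card := by
        rw [Finset.card_eq_sum_ones, ← Finset.sum_congr rfl hone, sum_cycleLength]
        congr 1
        ext x
        simp only [Finset.mem_filter, Finset.mem_univ, true_and, two_le_cycleLength_cycleThrough,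
          Finset.mem_compl, Equiv.Perm.mem_support]
      rw [Multiset.card_map, ← Finset.card_def, hcard, Finset.card_compl]
    · intro n hn
      obtain ⟨w, hw, rfl⟩ := Multiset.mem_map.1 hn
      exact hone w hw
  rw [← hlong, ← hshort, ← Multiset.map_add, Finset.filter_val, Finset.filter_val,
    Multiset.filter_add_not]

/-- The Young character counts the colourings of type `ν` that are constant on the cycles. -/
theorem youngCharacter_eq_card_invariant {r : ℕ} (ν : Composition r) (σ : Equiv.Perm (Fin r)) :
    youngCharacter ν σ =
      ((weightedMaps (fun _ => 1) ν.blocksFun).filter fun f => ∀ x, f (σ x) = f x).card := by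
  -- the coset of `g` corresponds to the colouring of `x` by the block of `ν` containing `g⁻¹ x`
  let colour : Equiv.Perm (Fin r) ⧸ youngSubgroup ν → Fin r → Fin ν.length :=
    Quotient.lift (fun g x => ν.index (g⁻¹ x)) (by
      intro g g' h
      have h' : g⁻¹ * g' ∈ youngSubgroup ν := QuotientGroup.leftRel_apply.1 h
      funext x
      have := h' (g'⁻¹ x)
      rwa [Equiv.Perm.mul_apply, perm_apply_inv] at this)
  have hcol : ∀ (g : Equiv.Perm (Fin r)) x, colour (g : Equiv.Perm (Fin r) ⧸ youngSubgroup ν) x =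
      ν.index (g⁻¹ x) := fun _ _ => rfl
  have hinj : Function.Injective colour := by
    intro p q h
    induction p using QuotientGroup.induction_on with | _ g =>
    induction q using QuotientGroup.induction_on with | _ g' =>
    refine QuotientGroup.eq.2 fun x => ?_
    have := congrFun h (g' x)
    rw [hcol, hcol] at this
    simpa using this
  have hsmul : ∀ p, σ • p = p ↔ ∀ x, colour p (σ x) = colour p x := by
    intro p
    rw [← hinj.eq_iff, funext_iff]
    induction p using QuotientGroup.induction_on with | _ g =>
    rw [← σ.forall_congr_right]
    refine forall_congr' fun x => ?_
    have : colour (σ • (g : Equiv.Perm (Fin r) ⧸ youngSubgroup ν)) (σ x) =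
        ν.index ((σ * g)⁻¹ (σ x)) := rfl
    rw [this, hcol, hcol, mul_inv_rev, Equiv.Perm.mul_apply,
      show σ⁻¹ (σ x) = x from σ.symm_apply_apply x, eq_comm]
  unfold youngCharacter inducedTrivialCharacter
  rw [← Nat.card_eq_finsetCard]
  refine Nat.card_congr (Equiv.ofBijective (fun p => ⟨colour p.1, ?_⟩) ⟨?_, ?_⟩)
  · refine Finset.mem_filter.2 ⟨?_, (hsmul p.1).1 p.2⟩
    obtain ⟨p, hp⟩ := p
    induction p using QuotientGroup.induction_on with | _ g =>
    exact index_comp_mem_weightedMaps ν g⁻¹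
  · intro p q h
    exact Subtype.ext (hinj (congrArg Subtype.val h))
  · rintro ⟨f, hf⟩
    obtain ⟨hf1, hf2⟩ := Finset.mem_filter.1 hf
    obtain ⟨τ, hτ⟩ := exists_eq_index_comp hf1
    have hc : colour ((τ⁻¹ : Equiv.Perm (Fin r)) : Equiv.Perm (Fin r) ⧸ youngSubgroup ν) = f := by
      funext x
      rw [hcol, inv_inv, hτ]
    exact ⟨⟨_, (hsmul _).2 (hc.symm ▸ hf2)⟩, Subtype.ext hc⟩

theorem youngCharacter_eq_card_weightedMaps_cycleLength {r : ℕ} (ν : Composition r)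
    (σ : Equiv.Perm (Fin r)) :
    youngCharacter ν σ = (weightedMaps (cycleLength σ) ν.blocksFun).card := by
  rw [youngCharacter_eq_card_invariant]
  symm
  have hmem : ∀ h : Cycles σ → Fin ν.length, (fun x => h (cycleThrough σ x)) ∈
      weightedMaps (fun _ => 1) ν.blocksFun ↔ h ∈ weightedMaps (cycleLength σ) ν.blocksFun := by
    intro h
    rw [mem_weightedMaps_one, mem_weightedMaps]
    refine forall_congr' fun j => ?_
    rw [sum_cycleLength]
    simp only [Finset.mem_filter, Finset.mem_univ, true_and]
  refine Finset.card_bij (fun h _ x => h (cycleThrough σ x)) ?_ ?_ ?_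
  · intro h hh
    refine Finset.mem_filter.2 ⟨(hmem h).2 hh, fun x => ?_⟩
    exact congrArg h (cycleThrough_eq_iff.2 (Equiv.Perm.sameCycle_apply_left.2 (.refl σ x)))
  · intro h _ h' _ he
    funext w
    obtain ⟨x, rfl⟩ := Quotient.exists_rep w
    exact congrFun he x
  · intro f hf
    obtain ⟨hf1, hf2⟩ := Finset.mem_filter.1 hf
    have hconst : ∀ x y, σ.SameCycle x y → f x = f y := by
      intro x y hxy
      obtain ⟨n, -, -, rfl⟩ := hxy.exists_pow_eq
      clear hxy
      induction n with
      | zero => rfl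
      | succ n ih => rw [pow_succ', Equiv.Perm.mul_apply, hf2, ih]
    exact ⟨Quotient.lift f hconst, (hmem _).1 hf1, rfl⟩

/-- The value of the Young character `φ^ν` on the class of cycle type `m₁, …, m_l` is the number of
ways to distribute the parts `m_i` over `k` boxes of capacities `ν₁, …, ν_k`, filling each. -/
theorem youngCharacter_eq_card_weightedMaps {r l : ℕ} (ν : Composition r) (σ : Equiv.Perm (Fin r))
    (m : Fin l → ℕ) (hm : (List.ofFn m : Multiset ℕ) = σ.partition.parts) :
    youngCharacter ν σ = (weightedMaps m ν.blocksFun).card := by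
  rw [youngCharacter_eq_card_weightedMaps_cycleLength]
  refine card_weightedMaps_congr _ ?_
  rw [map_cycleLength_eq_parts, ← hm, List.ofFn_eq_map, ← Multiset.map_coe]
  rfl

end YoungCharacters

/-! ### The filtration as a filtration by modules -/

section DescentModules

variable {R : Type*} [CommRing R] {V : Type*} [AddCommGroup V] [Module R V]

/-- On a product of Lie elements, `X^ν` gives a sum of rearrangements of that product, one for each
way to distribute the degrees over the parts of `ν`. -/
theorem descentElt_smul_of_mem_pbwProducts {r : ℕ} {lam : r.Partition} (ν : Composition r)
    {t : ⨂[R]^r V} (ht : t ∈ pbwProducts R V lam) :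
    descentElt R ν • t ∈ Submodule.span R (pbwProducts R V lam) ∧
    ∀ σ : Equiv.Perm (Fin r), σ.partition.parts = lam.parts →
      descentElt R ν • t - (youngCharacter ν σ : R) • t ∈ pbwFiltrationNext R V lam := by
  obtain ⟨μ, hμ, b, hb, hprod⟩ := ht
  have hparts : (List.ofFn μ.blocksFun : Multiset ℕ) = lam.parts := by
    rw [μ.ofFn_blocksFun, ← hμ]
    rfl
  choose t' ht' htp hsub using fun π => exists_rearrangement (fun i => μ.blocks_pos' _ i.2)
    hparts hb hprod π
  have hsum : descentElt R ν • t =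
      ∑ f ∈ weightedMaps μ.blocksFun ν.blocksFun, t' (Tuple.sort f) := by
    apply toTensorAlgebra_injective r
    rw [toTensorAlgebra_descentElt_smul, hprod, mulProj_iteratedCoproduct_prod ν.blocksFun
      (fun i => isPrimitive_of_mem_freeLie (hb i).2 _) (fun i => (hb i).1), map_sum]
    exact Finset.sum_congr rfl fun f _ => (htp _).symm
  constructor
  · rw [hsum]
    exact Submodule.sum_mem _ fun f _ => Submodule.subset_span (ht' _)
  · intro σ hσ
    rw [youngCharacter_eq_card_weightedMaps ν σ μ.blocksFun (hparts.trans hσ.symm), hsum,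
      Nat.cast_smul_eq_nsmul, ← Finset.sum_const, ← Finset.sum_sub_distrib]
    exact Submodule.sum_mem _ fun f _ => hsub _

theorem pbwFiltrationNext_le {r : ℕ} {lam θ : r.Partition} (h : partList lam ≤ partList θ) :
    pbwFiltrationNext R V θ ≤ pbwFiltrationNext R V lam :=
  Submodule.span_mono (Set.iUnion_subset fun η => Set.subset_iUnion
    (fun η : {η : r.Partition // partList lam < partList η} => pbwProducts R V η.1)
    ⟨η.1, lt_of_le_of_lt h η.2⟩)

theorem pbwFiltrationNext_le_pbwFiltration {r : ℕ} (lam : r.Partition) :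
    pbwFiltrationNext R V lam ≤ pbwFiltration R V lam :=
  Submodule.span_mono (Set.iUnion_subset fun η => Set.subset_iUnion
    (fun η : {η : r.Partition // partList lam ≤ partList η} => pbwProducts R V η.1)
    ⟨η.1, η.2.le⟩)

theorem descentAlgebra_induction {r : ℕ} {p : descentAlgebra R r → Prop}
    (basis : ∀ ν, p (descentBasis R r ν)) (zero : p 0) (add : ∀ X Y, p X → p Y → p (X + Y))
    (smul : ∀ (a : R) X, p X → p (a • X)) (X : descentAlgebra R r) : p X := by
  have h : X ∈ Submodule.span R (Set.range (descentBasis R r)) := by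
    rw [(descentBasis R r).span_eq]
    trivial
  induction h using Submodule.span_induction with
  | mem x hx =>
    obtain ⟨ν, rfl⟩ := hx
    exact basis ν
  | zero => exact zero
  | add x y _ _ hx hy => exact add x y hx hy
  | smul a x _ hx => exact smul a x hx

theorem descentBasis_smul {r : ℕ} (ν : Composition r) (w : ⨂[R]^r V) :
    descentBasis R r ν • w = descentElt R ν • w := by
  rw [← descentBasis_apply R ν]
  rfl

/-- The span of any union of sets `𝒳_θ` is stable under the descent algebra. -/
theorem smul_mem_span_iUnion {r : ℕ} {ι : Sort*} (θ : ι → r.Partition) (X : descentAlgebra R r)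
    {w : ⨂[R]^r V} (hw : w ∈ Submodule.span R (⋃ i, pbwProducts R V (θ i))) :
    X • w ∈ Submodule.span R (⋃ i, pbwProducts R V (θ i)) := by
  induction X using descentAlgebra_induction with
  | basis ν =>
    induction hw using Submodule.span_induction with
    | mem t ht =>
      obtain ⟨i, hi⟩ := Set.mem_iUnion.1 ht
      rw [descentBasis_smul]
      exact Submodule.span_mono (Set.subset_iUnion _ i)
        (descentElt_smul_of_mem_pbwProducts ν hi).1
    | zero =>
      rw [smul_zero]
      exact Submodule.zero_mem _
    | add x y _ _ hx hy =>
      rw [smul_add]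
      exact Submodule.add_mem _ hx hy
    | smul a x _ hx =>
      rw [smul_comm]
      exact Submodule.smul_mem _ a hx
  | zero =>
    rw [zero_smul]
    exact Submodule.zero_mem _
  | add X Y hX hY =>
    rw [add_smul]
    exact Submodule.add_mem _ hX hY
  | smul a X hX =>
    rw [smul_assoc]
    exact Submodule.smul_mem _ a hX

/-- `X` acts on `W_λ / W_{λ+}` as the scalar `(c_{r,R}(X))(λ)`. -/
theorem smul_sub_solomonMap_smul_mem {r : ℕ} {lam : r.Partition} {σ : Equiv.Perm (Fin r)}
    (hσ : σ.partition.parts = lam.parts) (X : descentAlgebra R r) {w : ⨂[R]^r V}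
    (hw : w ∈ pbwFiltration R V lam) :
    X • w - solomonMap R r X σ • w ∈ pbwFiltrationNext R V lam := by
  induction X using descentAlgebra_induction with
  | basis ν =>
    rw [solomonMap_descentBasis]
    unfold pbwFiltration at hw
    induction hw using Submodule.span_induction with
    | mem t ht =>
      obtain ⟨⟨θ, hθ⟩, hi⟩ := Set.mem_iUnion.1 ht
      rw [descentBasis_smul]
      rcases hθ.lt_or_eq with hlt | heq
      · -- both terms lie in the span of `𝒳_θ`, which is part of `W_{λ+}`
        have hle : Submodule.span R (pbwProducts R V θ) ≤ pbwFiltrationNext R V lam :=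
          Submodule.span_mono (Set.subset_iUnion
            (fun η : {η : r.Partition // partList lam < partList η} => pbwProducts R V η.1)
            ⟨θ, hlt⟩)
        exact Submodule.sub_mem _ (hle (descentElt_smul_of_mem_pbwProducts ν hi).1)
          (Submodule.smul_mem _ _ (hle (Submodule.subset_span hi)))
      · have hparts : lam.parts = θ.parts := by
          rw [← Multiset.sort_eq lam.parts (· ≥ ·), ← Multiset.sort_eq θ.parts (· ≥ ·)]
          exact congrArg _ heq
        exact pbwFiltrationNext_le hθ
          ((descentElt_smul_of_mem_pbwProducts ν hi).2 σ (hσ.trans hparts))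
    | zero =>
      rw [smul_zero, smul_zero, sub_zero]
      exact Submodule.zero_mem _
    | add x y _ _ hx hy =>
      rw [smul_add, smul_add, add_sub_add_comm]
      exact Submodule.add_mem _ hx hy
    | smul a x _ hx =>
      rw [smul_comm, smul_comm _ a x, ← smul_sub]
      exact Submodule.smul_mem _ a hx
  | zero =>
    rw [map_zero, Pi.zero_apply, zero_smul, zero_smul, sub_zero]
    exact Submodule.zero_mem _
  | add X Y hX hY =>
    rw [map_add, Pi.add_apply, add_smul, add_smul, add_sub_add_comm]
    exact Submodule.add_mem _ hX hY
  | smul a X hX =>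
    rw [map_smul, Pi.smul_apply, smul_assoc, smul_assoc, ← smul_sub]
    exact Submodule.smul_mem _ a hX

end DescentModules

end PBWDescent

/-- `U` and `U'` are `W_λ` and `W_{λ+}` as `D_{r,R}`-submodules of `T^r(V)`, and
`U.map U'.mkQ = W_λ / W_{λ+}`, a `D_{r,R}`-submodule of `T^r(V) / W_{λ+}`.  The permutation `σ` is any
element of the conjugacy class of `Sym(r)` indexed by `λ`, so that `solomonMap R r X σ` is the value
`(c_{r,R}(X))(λ)`. -/
theorem proposition3p3 {R : Type*} [CommRing R] (hR : IsField R ∨ Nonempty (R ≃+* ℤ))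
    {V : Type*} [AddCommGroup V] [Module R V] [Module.Free R V]
    (r : ℕ) (hr : 0 < r) (lam : r.Partition) :
    ∃ U U' : Submodule (PBWDescent.descentAlgebra R r) (⨂[R]^r V),
      U.restrictScalars R = PBWDescent.pbwFiltration R V lam ∧
      U'.restrictScalars R = PBWDescent.pbwFiltrationNext R V lam ∧
      U' ≤ U ∧
      ∀ (X : PBWDescent.descentAlgebra R r) (σ : Equiv.Perm (Fin r)),
        σ.partition.parts = lam.parts →
        ∀ x ∈ U.map U'.mkQ, X • x = PBWDescent.solomonMap R r X σ • x := by
  let U : Submodule (PBWDescent.descentAlgebra R r) (⨂[R]^r V) :=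
    { (PBWDescent.pbwFiltration R V lam).toAddSubmonoid with
      smul_mem' := fun X _ hw => PBWDescent.smul_mem_span_iUnion _ X hw }
  let U' : Submodule (PBWDescent.descentAlgebra R r) (⨂[R]^r V) :=
    { (PBWDescent.pbwFiltrationNext R V lam).toAddSubmonoid with
      smul_mem' := fun X _ hw => PBWDescent.smul_mem_span_iUnion _ X hw }
  refine ⟨U, U', rfl, rfl, PBWDescent.pbwFiltrationNext_le_pbwFiltration lam, ?_⟩
  rintro X σ hσ _ ⟨w, hw, rfl⟩
  have h : X • w - PBWDescent.solomonMap R r X σ • w ∈ U' :=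
    PBWDescent.smul_sub_solomonMap_smul_mem hσ X hw
  exact (Submodule.Quotient.eq U').2 h
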